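/- For $0<k<n$ let $\Delta_{n,k}=\operatorname{conv}\{x\in\{0,1\}^n : x_1+\cdots+x_n=k\}$, with faces $F_i=\Delta_{n,k}\cap\{x_i=0\}$ and $G_i=\Delta_{n,k}\cap\{x_i=1\}$. A combinatorial $(n,k)$-hypersimplex is a polytope whose face lattice is isomorphic to that of $\Delta_{n,k}$. A combinatorial $(6,2)$-hypersimplex $P\subset\mathbb R^5$ is $G$-generic if the hyperplanes supporting its $G$-facets (the facets of $P$ that are combinatorial $(5,1)$-hypersimplices) neither have a common point nor are all parallel to a common line. A real $6\times 6$ matrix with columns $g_1,\dots,g_6$ is a $G$-matrix of $P$ if there is a linear isomorphism $\mathbb R^6\to\mathbb R\times\mathbb R^5$ that maps $\{x\in\mathbb R^6: x_i\ge 0,\ \langle g_i,x\rangle\ge 0 \text{ for } i=1,\dots,6\}$ onto the homogenization $\operatorname{cone}(\{1\}\times P)$, and a face lattice isomorphism from $\Delta_{6,2}$ to $P$ under which, in these coordinates, $F_i$ corresponds to the face of $P$ given by $x_i=0$ and $G_i$ to the face of $P$ given by $\langle g_i,x\rangle=0$. **Proposition.** There exist combinatorial $(6,2)$-hypersimplices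 $P\subset\mathbb R^5$ that are not $G$-generic. More precisely, there is such a $P$ having the $G$-matrix $$\begin{pmatrix} -1 & 5+2\sqrt6 & 5-2\sqrt6 & 1 & 1 & 1\\ 5-2\sqrt6 & -1 & 5+2\sqrt6 & 1 & 1 & 1\\ 5+2\sqrt6 & 5-2\sqrt6 & -1 & 1 & 1 & 1\\ 1 & 1 & 1 & -1 & 1 & 1\\ 1 & 1 & 1 & 1 & -1 & 1\\ 1 & 1 & 1 & 1 & 1 & -1 \end{pmatrix},$$ and the determinant of this matrix is $0$. -/

import Mathlib

open scoped Matrix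

section Polytopes

variable {E E' : Type*} [AddCommGroup E] [Module ℝ E] [TopologicalSpace E]
  [AddCommGroup E'] [Module ℝ E'] [TopologicalSpace E']

/-- A (convex) polytope: the convex hull of a finite set of points. -/
def IsPolytope (P : Set E) : Prop :=
  ∃ s : Set E, s.Finite ∧ P = convexHull ℝ s

/-- The faces of `P`, partially ordered by inclusion. A face is the empty set or the set of all
maximizers of a linear functional over `P`; in particular `∅` and `P` itself are faces. -/
abbrev FaceLattice (P : Set E) : Type _ := {F : Set E // IsExposed ℝ P F}

/-- Two polytopes are combinatorially isomorphic if their face lattices are isomorphic. -/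
def CombIso (P : Set E) (Q : Set E') : Prop :=
  Nonempty (FaceLattice P ≃o FaceLattice Q)

/-- A facet: an inclusion-maximal proper face. -/
def IsFacet (P F : Set E) : Prop :=
  Maximal (fun F' : Set E => IsExposed ℝ P F' ∧ F' ≠ P) F

/-- The homogenization `cone ({1} × P)`: the convex cone generated by `{1} × P`. -/
def homogenization (P : Set E) : Set (ℝ × E) :=
  (PointedCone.hull ℝ (({1} : Set ℝ) ×ˢ P) : PointedCone ℝ (ℝ × E))

end Polytopes

section Hypersimplices

/-- The `(n,k)`-hypersimplex: the convex hull of the `0/1`-vectors with coordinate sum `k`. -/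
def hypersimplex (n k : ℕ) : Set (Fin n → ℝ) :=
  convexHull ℝ {x | (∀ i, x i = 0 ∨ x i = 1) ∧ ∑ i, x i = (k : ℝ)}

theorem hypersimplex_coord_mem {n k : ℕ} {x : Fin n → ℝ} (hx : x ∈ hypersimplex n k)
    (i : Fin n) : 0 ≤ x i ∧ x i ≤ 1 := by
  have hconv : Convex ℝ {y : Fin n → ℝ | y i ∈ Set.Icc (0 : ℝ) 1} :=
    (convex_Icc (0 : ℝ) 1).linear_preimage (LinearMap.proj i : (Fin n → ℝ) →ₗ[ℝ] ℝ)
  have h : x ∈ {y : Fin n → ℝ | y i ∈ Set.Icc (0 : ℝ) 1} := by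
    refine convexHull_min ?_ hconv hx
    rintro y ⟨hy, -⟩
    rcases hy i with h | h <;> simp [h]
  exact h

/-- The face `F_i = {x_i = 0}` of the hypersimplex. -/
def hypersimplexF (n k : ℕ) (i : Fin n) : FaceLattice (hypersimplex n k) :=
  ⟨{x ∈ hypersimplex n k | x i = 0}, by
    rintro ⟨w, hw, hwi⟩
    refine ⟨-ContinuousLinearMap.proj i, ?_⟩
    ext x
    constructor
    · rintro ⟨hx, hxi⟩
      refine ⟨hx, fun y hy => ?_⟩
      simpa [hxi] using (hypersimplex_coord_mem hy i).1
    · rintro ⟨hx, h⟩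
      refine ⟨hx, le_antisymm ?_ (hypersimplex_coord_mem hx i).1⟩
      simpa [hwi] using h w hw⟩

/-- The face `G_i = {x_i = 1}` of the hypersimplex. -/
def hypersimplexG (n k : ℕ) (i : Fin n) : FaceLattice (hypersimplex n k) :=
  ⟨{x ∈ hypersimplex n k | x i = 1}, by
    rintro ⟨w, hw, hwi⟩
    refine ⟨ContinuousLinearMap.proj i, ?_⟩
    ext x
    constructor
    · rintro ⟨hx, hxi⟩
      refine ⟨hx, fun y hy => ?_⟩
      simpa [hxi] using (hypersimplex_coord_mem hy i).2
    · rintro ⟨hx, h⟩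
      refine ⟨hx, le_antisymm (hypersimplex_coord_mem hx i).2 ?_⟩
      simpa [hwi] using h w hw⟩

variable {E : Type*} [AddCommGroup E] [Module ℝ E] [TopologicalSpace E]

/-- A combinatorial `(n,k)`-hypersimplex: a polytope whose face lattice is isomorphic to that of
the `(n,k)`-hypersimplex. -/
def IsCombHypersimplex (n k : ℕ) (P : Set E) : Prop :=
  IsPolytope P ∧ CombIso (hypersimplex n k) P

/-- A `G`-facet of a combinatorial `(n,k)`-hypersimplex `P`, `2 ≤ k ≤ n - 2`: a facet that is a
combinatorial `(n-1,k-1)`-hypersimplex. -/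
def IsGFacet (n k : ℕ) (P F : Set E) : Prop :=
  IsFacet P F ∧ IsCombHypersimplex (n - 1) (k - 1) F

/-- `G`-genericity of a combinatorial `(n,k)`-hypersimplex `P`: the hyperplanes supporting the
`G`-facets (the affine hulls of these facets) are not projectively concurrent, i.e. they have no
common point and they are not all parallel to a common line. -/
def IsGGeneric (n k : ℕ) (P : Set E) : Prop :=
  (¬ ∃ x : E, ∀ F : Set E, IsGFacet n k P F → x ∈ affineSpan ℝ F) ∧
  (¬ ∃ v : E, v ≠ 0 ∧ ∀ F : Set E, IsGFacet n k P F → v ∈ (affineSpan ℝ F).direction)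

/-- `G` is a `G`-matrix of the combinatorial `(n,k)`-hypersimplex `P`. After a linear change of
coordinates `L`, the homogenization of `P` is the cone of all `x` with `x_i ≥ 0` and
`⟨g_i, x⟩ ≥ 0` for all `i`, where `g_i` is the `i`-th column of `G` (that is, `⟨g_i, x⟩` is the
`i`-th entry of `x ᵥ* G`); and there is an isomorphism of face lattices under which `F_i`
corresponds to the face of `P` where `x_i = 0`, and `G_i` to the face where `⟨g_i, x⟩ = 0`. -/
def IsGMatrix (n k : ℕ) (P : Set E) (G : Matrix (Fin n) (Fin n) ℝ) : Prop :=
  ∃ L : (Fin n → ℝ) ≃ₗ[ℝ] ℝ × E,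
    homogenization P = L '' {x | (∀ i, 0 ≤ x i) ∧ ∀ i, 0 ≤ (x ᵥ* G) i} ∧
    ∃ Φ : FaceLattice (hypersimplex n k) ≃o FaceLattice P,
      (∀ i, (Φ (hypersimplexF n k i) : Set E) = {p ∈ P | L.symm (1, p) i = 0}) ∧
      (∀ i, (Φ (hypersimplexG n k i) : Set E) = {p ∈ P | (L.symm (1, p) ᵥ* G) i = 0})

end Hypersimplices

/-- The explicit `6 × 6` matrix with entries `±1` and `5 ± 2√6`. -/
noncomputable def singularGMatrix : Matrix (Fin 6) (Fin 6) ℝ :=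
  !![-1, 5 + 2 * √6, 5 - 2 * √6, 1, 1, 1;
     5 - 2 * √6, -1, 5 + 2 * √6, 1, 1, 1;
     5 + 2 * √6, 5 - 2 * √6, -1, 1, 1, 1;
     1, 1, 1, -1, 1, 1;
     1, 1, 1, 1, -1, 1;
     1, 1, 1, 1, 1, -1]

/-! ### Face lattices from vertex-facet incidences. -/

section ExposedFaces

variable {ι κ E : Type*} [NormedAddCommGroup E] [NormedSpace ℝ E]

/-! Call a matrix reciprocal if its diagonal is `-1`, its other entries are positive, and mirror
entries are inverse to each other. The extreme rays of the cone `gCone G` of such a `G` are spanned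
by the vectors `e_i + G_ij e_j`, and reciprocity makes the orders `(i, j)` and `(j, i)` give the
same ray. The form `x_k` vanishes on this ray iff `k ∉ {i, j}`, and the form of column `k` iff `k ∈
{i, j}`. These incidences do not depend on `G`, and the hypersimplex is the case where all
off-diagonal entries are `1`. As incidences determine the face lattice (`exists_orderIso`), every
slice of such a cone by a positive coordinate sum is a combinatorial `(n,2)`-hypersimplex with
`G`-matrix `G` (`isGMatrix_and_isCombHypersimplex`).

The given matrix is reciprocal and has a left null vector of coordinate sum `1`. This yields
determinant `0` and a common point of the affine hulls of all facets of column type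
(`mem_affineSpan_of_vecMul_eq_zero`). Since `G`-facets are defined by combinatorial type, the facets
`x_k = 0` must still be excluded: they have ten disjoint nonempty faces, too many for a 4-simplex
(`card_le_of_combIso_facet`). -/

theorem exists_weights_of_mem_convexHull_range [Fintype ι] {v : ι → E} {x : E}
    (hx : x ∈ convexHull ℝ (Set.range v)) :
    ∃ w : ι → ℝ, (∀ i, 0 ≤ w i) ∧ ∑ i, w i = 1 ∧ ∑ i, w i • v i = x := by
  classical
  rw [convexHull_range_eq_exists_affineCombination] at hx
  obtain ⟨s, w, hw, hs, rfl⟩ := hx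
  refine ⟨fun i => if i ∈ s then w i else 0, fun i => ?_, ?_, ?_⟩
  · dsimp only
    split_ifs with h
    exacts [hw i h, le_rfl]
  · simpa using hs
  · rw [Finset.affineCombination_eq_linear_combination _ _ _ hs]
    simp [ite_smul]

theorem AffineMap.map_sum_smul {s : Finset ι} {w : ι → ℝ} (hw : ∑ i ∈ s, w i = 1)
    (f : E →ᵃ[ℝ] ℝ) (v : ι → E) : f (∑ i ∈ s, w i • v i) = ∑ i ∈ s, w i * f (v i) := by
  rw [← Finset.affineCombination_eq_linear_combination _ _ _ hw, Finset.map_affineCombination _ _ _ hw,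
    Finset.affineCombination_eq_linear_combination _ _ _ hw]
  rfl

/-- A face of a polytope contains every vertex that has positive weight in a convex combination
lying on that face. -/
theorem IsExposed.mem_of_weight_ne_zero [Fintype ι] {v : ι → E} {F : Set E}
    (hF : IsExposed ℝ (convexHull ℝ (Set.range v)) F) {w : ι → ℝ} (hw : ∀ i, 0 ≤ w i)
    (hw1 : ∑ i, w i = 1) (hx : ∑ i, w i • v i ∈ F) {i : ι} (hi : w i ≠ 0) : v i ∈ F := by
  obtain ⟨l, rfl⟩ := hF ⟨_, hx⟩
  have hv : ∀ j, v j ∈ convexHull ℝ (Set.range v) := fun j => subset_convexHull ℝ _ ⟨j, rfl⟩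
  set M := l (∑ i, w i • v i) with hM
  have hle : ∀ j, 0 ≤ w j * (M - l (v j)) := fun j =>
    mul_nonneg (hw j) (sub_nonneg.2 (hx.2 _ (hv j)))
  have hsum : ∑ j, w j * (M - l (v j)) = 0 := by
    simp only [mul_sub, Finset.sum_sub_distrib, ← Finset.sum_mul, hw1]
    simp [hM]
  have h0 := (Finset.sum_eq_zero_iff_of_nonneg fun j _ => hle j).1 hsum i (Finset.mem_univ i)
  have hli : l (v i) = M := by
    rcases mul_eq_zero.1 h0 with h | h
    · exact absurd h hi
    · linarith
  exact ⟨hv i, fun y hy => hli ▸ hx.2 y hy⟩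

theorem IsExposed.exists_vertex_mem [Fintype ι] {v : ι → E} {F : Set E}
    (hF : IsExposed ℝ (convexHull ℝ (Set.range v)) F) (hne : F.Nonempty) : ∃ i, v i ∈ F := by
  obtain ⟨x, hx⟩ := hne
  obtain ⟨w, hw, hw1, rfl⟩ := exists_weights_of_mem_convexHull_range (hF.subset hx)
  obtain ⟨i, -, hi⟩ : ∃ i ∈ Finset.univ, w i ≠ 0 :=
    Finset.exists_ne_zero_of_sum_ne_zero (by rw [hw1]; exact one_ne_zero)
  exact ⟨i, hF.mem_of_weight_ne_zero hw hw1 hx hi⟩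

/-- A description of `P` both as the convex hull of the points `v i` and by the inequalities
`0 ≤ h k x`; the latter cut out `P` inside its affine span. -/
structure IsDoubleDescription (P : Set E) (v : ι → E) (h : κ → E →ᵃ[ℝ] ℝ) : Prop where
  eq_hull : P = convexHull ℝ (Set.range v)
  nonneg : ∀ k, ∀ x ∈ P, 0 ≤ h k x
  lineMap_mem : ∀ x ∈ P, ∀ y ∈ P, ∀ t : ℝ,
    (∀ k, 0 ≤ h k (AffineMap.lineMap x y t)) → AffineMap.lineMap x y t ∈ P
  -- This makes the intersection of all facets empty, so that `∅` is an intersection of facets too.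
  exists_ne : ∀ i, ∃ k, h k (v i) ≠ 0

/-- The sets of vertices closed with respect to an incidence relation between facets and
vertices: those that contain all vertices lying on all their common facets. -/
abbrev IncidenceClosed (I : κ → ι → Prop) : Type _ :=
  {A : Set ι // ∀ i, (∀ k, (∀ j ∈ A, I k j) → I k i) → i ∈ A}

namespace IsDoubleDescription

variable {P : Set E} {v : ι → E} {h : κ → E →ᵃ[ℝ] ℝ}

theorem vertex_mem (H : IsDoubleDescription P v h) (i : ι) : v i ∈ P := by
  rw [H.eq_hull]
  exact subset_convexHull ℝ _ ⟨i, rfl⟩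

theorem exists_vertex_mem [Fintype ι] (H : IsDoubleDescription P v h) {F : Set E}
    (hF : IsExposed ℝ P F) (hne : F.Nonempty) : ∃ i, v i ∈ F := by
  have hF' := hF
  rw [H.eq_hull] at hF'
  exact hF'.exists_vertex_mem hne

theorem eq_zero_of_mem [Fintype ι] (H : IsDoubleDescription P v h) {F : Set E}
    (hF : IsExposed ℝ P F) {x : E} (hx : x ∈ F) {k : κ} (hk : ∀ j, v j ∈ F → h k (v j) = 0) :
    h k x = 0 := by
  have hF' := hF
  rw [H.eq_hull] at hF'
  obtain ⟨w, hw, hw1, rfl⟩ := exists_weights_of_mem_convexHull_range (hF'.subset hx)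
  rw [AffineMap.map_sum_smul hw1]
  refine Finset.sum_eq_zero fun i _ => ?_
  by_cases hi : w i = 0
  · simp [hi]
  · rw [hk i (hF'.mem_of_weight_ne_zero hw hw1 hx hi), mul_zero]

/-- Every nonempty face has a point off all facets that do not contain the whole face. -/
theorem exists_relint [Fintype ι] (H : IsDoubleDescription P v h) {F : Set E}
    (hF : IsExposed ℝ P F) (hne : F.Nonempty) :
    ∃ x ∈ F, ∀ k, h k x = 0 → ∀ j, v j ∈ F → h k (v j) = 0 := by
  classical
  obtain ⟨i₀, hi₀⟩ := H.exists_vertex_mem hF hne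
  set J : Finset ι := Finset.univ.filter fun j => v j ∈ F with hJ
  have hJF : ∀ {j}, j ∈ J ↔ v j ∈ F := by simp [hJ]
  have hcard : (0 : ℝ) < J.card := by
    exact_mod_cast Finset.card_pos.2 ⟨i₀, hJF.2 hi₀⟩
  have hw1 : ∑ _j ∈ J, (J.card : ℝ)⁻¹ = 1 := by
    rw [Finset.sum_const, nsmul_eq_mul, mul_inv_cancel₀ hcard.ne']
  have hconv : Convex ℝ P := by rw [H.eq_hull]; exact convex_convexHull ℝ _
  -- The barycentre of the vertices in `F`: a nonnegative form vanishing there vanishes at each of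
  -- them.
  refine ⟨∑ j ∈ J, (J.card : ℝ)⁻¹ • v j, (hF.convex hconv).sum_mem
    (fun _ _ => by positivity) hw1 fun j hj => hJF.1 hj, fun k hk j hj => ?_⟩
  rw [AffineMap.map_sum_smul hw1, Finset.sum_eq_zero_iff_of_nonneg] at hk
  · simpa [hcard.ne'] using hk j (hJF.2 hj)
  · exact fun i _ => mul_nonneg (by positivity) (H.nonneg k _ (H.vertex_mem i))

/-- Every face is the intersection of the facets containing it. -/
theorem eq_inter_facets [Fintype ι] [Finite κ] (H : IsDoubleDescription P v h) {F : Set E}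
    (hF : IsExposed ℝ P F) :
    F = {x ∈ P | ∀ k, (∀ j, v j ∈ F → h k (v j) = 0) → h k x = 0} := by
  refine Set.Subset.antisymm
    (fun x hx => ⟨hF.subset hx, fun k hk => H.eq_zero_of_mem hF hx hk⟩) ?_
  rintro y ⟨hy, hyk⟩
  rcases F.eq_empty_or_nonempty with rfl | hne
  · exfalso
    have hall : ∀ k, h k y = 0 := fun k => hyk k (by simp)
    have hy' := hy
    rw [H.eq_hull] at hy'
    obtain ⟨w, hw, hw1, rfl⟩ := exists_weights_of_mem_convexHull_range hy'
    obtain ⟨i, -, hi⟩ : ∃ i ∈ Finset.univ, w i ≠ 0 :=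
      Finset.exists_ne_zero_of_sum_ne_zero (by rw [hw1]; exact one_ne_zero)
    obtain ⟨k, hk⟩ := H.exists_ne i
    have := hall k
    rw [AffineMap.map_sum_smul hw1, Finset.sum_eq_zero_iff_of_nonneg fun j _ =>
      mul_nonneg (hw j) (H.nonneg k _ (H.vertex_mem j))] at this
    exact (mul_ne_zero hi hk) (this i (Finset.mem_univ i))
  obtain ⟨x, hx, hxk⟩ := H.exists_relint hF hne
  obtain ⟨l, hl⟩ := hF hne
  -- Prolong the segment from `y` to the relative interior point `x` slightly beyond `x`, staying in
  -- `P`. As `l` is maximal at `x`, it cannot increase there, so `l x ≤ l y`.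
  have hline : ∀ k (ε : ℝ), h k (AffineMap.lineMap x y (-ε)) = h k x + ε * (h k x - h k y) := by
    intro k ε
    rw [AffineMap.apply_lineMap, AffineMap.lineMap_apply]
    simp
    ring
  have hev : ∀ᶠ ε : ℝ in nhdsWithin 0 (Set.Ioi 0), ∀ k, 0 ≤ h k (AffineMap.lineMap x y (-ε)) := by
    refine Filter.eventually_all.2 fun k => ?_
    by_cases hk : h k x = 0
    · refine Filter.Eventually.of_forall fun ε => ?_
      rw [hline, hyk k (hxk k hk), hk]
      simp
    · have hpos : 0 < h k x := lt_of_le_of_ne (H.nonneg k x (hF.subset hx)) (Ne.symm hk)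
      have hcont : ContinuousAt (fun ε : ℝ => h k x + ε * (h k x - h k y)) 0 := by fun_prop
      have h0 : 0 < h k x + 0 * (h k x - h k y) := by simpa using hpos
      refine Filter.Eventually.mono
        (nhdsWithin_le_nhds (hcont.eventually (lt_mem_nhds h0))) fun ε hε => ?_
      rw [hline]
      exact hε.le
  obtain ⟨ε, hε, hεpos⟩ := (hev.and self_mem_nhdsWithin).exists
  have hεpos' : 0 < ε := hεpos
  have hz := H.lineMap_mem x (hF.subset hx) y hy (-ε) hε
  rw [hl] at hx ⊢
  have h1 := hx.2 _ hz
  rw [AffineMap.lineMap_apply_module, map_add, map_smul, map_smul, smul_eq_mul, smul_eq_mul] at h1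
  have h2 : l x ≤ l y := by nlinarith
  exact ⟨hy, fun z hz => (hx.2 z hz).trans h2⟩

theorem isExposed_inter_facets [FiniteDimensional ℝ E] [Fintype κ] (H : IsDoubleDescription P v h)
    (p : κ → Prop) : IsExposed ℝ P {x ∈ P | ∀ k, p k → h k x = 0} := by
  classical
  rintro ⟨x₀, hx₀, hx₀'⟩
  set K : Finset κ := Finset.univ.filter p with hK
  have hKp : ∀ {k}, k ∈ K ↔ p k := by simp [hK]
  -- Up to a constant, `f` is minus the sum of the selected forms. At `x₀` this sum attains its
  -- minimum `0`, so the maximizers of `f` are the common zeros.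
  set f : E →ₗ[ℝ] ℝ := -∑ k ∈ K, (h k).linear with hf
  have hfh : ∀ x, f x = (∑ k ∈ K, h k 0) - ∑ k ∈ K, h k x := by
    intro x
    have : ∀ k, (h k).linear x = h k x - h k 0 := fun k => by
      have := (h k).linearMap_vsub x 0
      simpa using this
    simp [hf, this]
  refine ⟨LinearMap.toContinuousLinearMap f, ?_⟩
  ext x
  simp only [LinearMap.coe_toContinuousLinearMap', Set.mem_ofPred_eq, hfh]
  refine and_congr_right fun hx => ⟨fun hxk y hy => ?_, fun hmax k hk => ?_⟩
  · rw [Finset.sum_eq_zero fun k hk => hxk k (hKp.1 hk)]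
    have : 0 ≤ ∑ k ∈ K, h k y := Finset.sum_nonneg fun k _ => H.nonneg k y hy
    linarith
  · have h0 := hmax x₀ hx₀
    rw [Finset.sum_eq_zero fun k hk => hx₀' k (hKp.1 hk)] at h0
    have hnn : ∀ k ∈ K, 0 ≤ h k x := fun k _ => H.nonneg k x hx
    exact (Finset.sum_eq_zero_iff_of_nonneg hnn).1
      (le_antisymm (by linarith) (Finset.sum_nonneg hnn)) k (hKp.2 hk)

/-- The face lattice only depends on the vertex-facet incidences. -/
def faceLatticeIso [FiniteDimensional ℝ E] [Fintype ι] [Fintype κ] (H : IsDoubleDescription P v h)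
    (I : κ → ι → Prop) (hI : ∀ k i, h k (v i) = 0 ↔ I k i) :
    FaceLattice P ≃o IncidenceClosed I where
  toFun F := ⟨{i | v i ∈ F.1}, fun i hi => by
    have := H.eq_inter_facets F.2
    simp only [hI] at this
    rw [Set.mem_ofPred_eq, this]
    exact ⟨H.vertex_mem i, fun k hk => (hI k i).2 (hi k hk)⟩⟩
  invFun A := ⟨{x ∈ P | ∀ k, (∀ j ∈ A.1, I k j) → h k x = 0}, H.isExposed_inter_facets _⟩
  left_inv F := Subtype.ext <| by
    have := H.eq_inter_facets F.2
    simp only [hI] at this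
    exact this.symm
  right_inv A := Subtype.ext <| by
    ext i
    exact ⟨fun hi => A.2 i fun k hk => (hI k i).1 (hi.2 k hk),
      fun hi => ⟨H.vertex_mem i, fun k hk => (hI k i).2 (hk i hi)⟩⟩
  map_rel_iff' := by
    intro F F'
    refine ⟨fun hle x hx => ?_, fun hle i hi => hle hi⟩
    rw [H.eq_inter_facets F.2] at hx
    rw [H.eq_inter_facets F'.2]
    exact ⟨hx.1, fun k hk => hx.2 k fun j hj => hk j (hle hj)⟩

theorem isExposed_facet [FiniteDimensional ℝ E] [Fintype κ] (H : IsDoubleDescription P v h)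
    (k : κ) : IsExposed ℝ P {x ∈ P | h k x = 0} := by
  simpa using H.isExposed_inter_facets (· = k)

/-- Two doubly described polytopes with the same vertex-facet incidences have isomorphic face
lattices, and the isomorphism matches the facets. -/
theorem exists_orderIso {E' : Type*} [NormedAddCommGroup E'] [NormedSpace ℝ E']
    [FiniteDimensional ℝ E] [FiniteDimensional ℝ E'] [Fintype ι] [Fintype κ] {P' : Set E'}
    {v' : ι → E'} {h' : κ → E' →ᵃ[ℝ] ℝ} (H : IsDoubleDescription P v h)
    (H' : IsDoubleDescription P' v' h') (hh : ∀ k i, h k (v i) = 0 ↔ h' k (v' i) = 0) :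
    ∃ Φ : FaceLattice P ≃o FaceLattice P', ∀ k (F : FaceLattice P), F.1 = {x ∈ P | h k x = 0} →
      (Φ F).1 = {x ∈ P' | h' k x = 0} := by
  set e := H.faceLatticeIso (fun k i => h' k (v' i) = 0) hh
  set e' := H'.faceLatticeIso (fun k i => h' k (v' i) = 0) fun _ _ => Iff.rfl
  refine ⟨e.trans e'.symm, fun k F hF => ?_⟩
  have : e F = e' ⟨_, H'.isExposed_facet k⟩ := by
    refine Subtype.ext (Set.ext fun i => ?_)
    change v i ∈ F.1 ↔ v' i ∈ P' ∧ h' k (v' i) = 0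
    rw [hF, Set.mem_ofPred_eq, hh]
    simp [H.vertex_mem, H'.vertex_mem]
  rw [OrderIso.trans_apply, this, OrderIso.symm_apply_apply]

theorem isPolytope [Finite ι] (H : IsDoubleDescription P v h) : IsPolytope P :=
  ⟨_, Set.finite_range v, H.eq_hull⟩

/-- Every facet is given by one of the inequalities, provided none of these is an equality. -/
theorem eq_of_isFacet [FiniteDimensional ℝ E] [Fintype ι] [Fintype κ]
    (H : IsDoubleDescription P v h) (hne : ∀ k, ∃ i, h k (v i) ≠ 0) {F : Set E}
    (hF : IsFacet P F) : ∃ k, F = {x ∈ P | h k x = 0} := by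
  obtain ⟨⟨hexp, hFP⟩, hmax⟩ := hF
  have hF := H.eq_inter_facets hexp
  obtain ⟨k, hk⟩ : ∃ k, ∀ j, v j ∈ F → h k (v j) = 0 := by
    by_contra! hcon
    refine hFP (hF.trans (Set.sep_eq_self_iff_mem_true.2 fun x _ k hk => ?_))
    obtain ⟨j, hj, hj'⟩ := hcon k
    exact absurd (hk j hj) hj'
  have hle : F ⊆ {x ∈ P | h k x = 0} := fun x hx =>
    ⟨hexp.subset hx, H.eq_zero_of_mem hexp hx hk⟩
  refine ⟨k, hle.antisymm (hmax ⟨H.isExposed_facet k, fun heq => ?_⟩ hle)⟩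
  obtain ⟨i, hi⟩ := hne k
  exact hi (heq.ge (H.vertex_mem i)).2

end IsDoubleDescription

/-- The convex hull of `Fintype.card ι` points has at most `Fintype.card ι` pairwise disjoint
nonempty faces, and this carries over to combinatorially isomorphic sets. -/
theorem card_le_of_combIso {τ E' : Type*} [Fintype ι] [Fintype τ] [NormedAddCommGroup E']
    [NormedSpace ℝ E'] {v : ι → E} {Q : Set E'}
    (hQ : CombIso (convexHull ℝ (Set.range v)) Q) {f : τ → Set E'} (hf : ∀ t, IsExposed ℝ Q (f t))
    (hne : ∀ t, (f t).Nonempty) (hdisj : Pairwise (Function.onFun Disjoint f)) :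
    Fintype.card τ ≤ Fintype.card ι := by
  obtain ⟨Φ⟩ := hQ
  have hempty : (Φ ⟨∅, fun h => absurd h Set.not_nonempty_empty⟩).1 = ∅ := by
    have : Φ ⟨∅, fun h => absurd h Set.not_nonempty_empty⟩ ≤
        ⟨∅, fun h => absurd h Set.not_nonempty_empty⟩ :=
      (OrderIso.le_symm_apply Φ).1 (Set.empty_subset _)
    exact Set.subset_empty_iff.1 this
  have hsymm : ∀ t, (Φ.symm ⟨f t, hf t⟩).1.Nonempty := by
    intro t
    rw [Set.nonempty_iff_ne_empty]
    intro h0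
    have h1 : Φ.symm ⟨f t, hf t⟩ = ⟨∅, fun h => absurd h Set.not_nonempty_empty⟩ := Subtype.ext h0
    rw [OrderIso.symm_apply_eq] at h1
    exact (hne t).ne_empty ((congrArg Subtype.val h1).trans hempty)
  choose g hg using fun t => (Φ.symm ⟨f t, hf t⟩).2.exists_vertex_mem (hsymm t)
  refine Fintype.card_le_of_injective g fun s t hst => ?_
  by_contra hne'
  -- A vertex chosen for both `s` and `t` lies in `B`, while `Φ B` lies in two disjoint faces and
  -- hence is empty.
  set B : FaceLattice (convexHull ℝ (Set.range v)) :=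
    ⟨_, (Φ.symm ⟨f s, hf s⟩).2.inter (Φ.symm ⟨f t, hf t⟩).2⟩ with hB
  have hs : Φ B ≤ ⟨f s, hf s⟩ := (OrderIso.le_symm_apply Φ).1 Set.inter_subset_left
  have ht : Φ B ≤ ⟨f t, hf t⟩ := (OrderIso.le_symm_apply Φ).1 Set.inter_subset_right
  have hΦB : Φ B ≤ Φ ⟨∅, fun h => absurd h Set.not_nonempty_empty⟩ := by
    intro x hx
    exact absurd (ht hx) (Set.disjoint_left.1 (hdisj hne') (hs hx))
  exact Set.notMem_empty _ (Φ.le_iff_le.1 hΦB (⟨hg s, hst ▸ hg t⟩ : v (g s) ∈ B.1))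

end ExposedFaces

/-! ### Reciprocal matrices and the extreme rays of their cones. -/

section ReciprocalMatrices

set_option linter.unusedSectionVars false

variable {m : Type*} [Fintype m]

/-- The cone cut out by the coordinates and by the columns of `G`. -/
def gCone (G : Matrix m m ℝ) : Set (m → ℝ) :=
  {x | (∀ i, 0 ≤ x i) ∧ ∀ i, 0 ≤ (x ᵥ* G) i}

/-- Matrices with diagonal entries `-1` and positive off-diagonal entries such that entries in
mirror positions are reciprocal. -/
structure IsReciprocal (G : Matrix m m ℝ) : Prop where
  diag : ∀ i, G i i = -1
  pos : ∀ i j, i ≠ j → 0 < G i j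
  recip : ∀ i j, i ≠ j → G i j * G j i = 1

theorem smul_mem_gCone {G : Matrix m m ℝ} {x : m → ℝ} (hx : x ∈ gCone G) {c : ℝ} (hc : 0 ≤ c) :
    c • x ∈ gCone G := by
  refine ⟨fun i => mul_nonneg hc (hx.1 i), fun i => ?_⟩
  rw [Matrix.smul_vecMul]
  exact mul_nonneg hc (hx.2 i)

theorem add_mem_gCone {G : Matrix m m ℝ} {x y : m → ℝ} (hx : x ∈ gCone G) (hy : y ∈ gCone G) :
    x + y ∈ gCone G := by
  refine ⟨fun i => add_nonneg (hx.1 i) (hy.1 i), fun i => ?_⟩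
  rw [Matrix.add_vecMul]
  exact add_nonneg (hx.2 i) (hy.2 i)

/-- Moving from a point with nonnegative coordinates `a` in direction `-b` until the first
coordinate vanishes. -/
theorem exists_first_zero {κ : Type*} [Fintype κ] (a b : κ → ℝ) (ha : ∀ k, 0 ≤ a k)
    (hb : ∃ k, 0 < b k) :
    ∃ t, 0 ≤ t ∧ (∀ k, 0 ≤ a k - t * b k) ∧ ∃ k, 0 < b k ∧ a k - t * b k = 0 := by
  classical
  obtain ⟨k₀, hk₀⟩ := hb
  obtain ⟨k, hk, hmin⟩ := (Finset.univ.filter fun k => 0 < b k).exists_min_image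
    (fun k => a k / b k) ⟨k₀, by simpa using hk₀⟩
  have hbk : 0 < b k := by simpa using hk
  have ht : 0 ≤ a k / b k := div_nonneg (ha k) hbk.le
  refine ⟨a k / b k, ht, fun l => ?_, k, hbk, by field_simp; ring⟩
  rcases le_or_gt (b l) 0 with hl | hl
  · have := mul_nonpos_of_nonneg_of_nonpos ht hl
    linarith [ha l]
  · have := (le_div_iff₀ hl).1 (hmin l (by simpa using hl))
    linarith

variable [DecidableEq m]

/-- The point `e_i + G_ij e_j`, which spans the extreme ray of `gCone G` belonging to `{i, j}`. -/
def edgeRay (G : Matrix m m ℝ) (i j : m) : m → ℝ :=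
  Pi.single i 1 + Pi.single j (G i j)

theorem edgeRay_vecMul (G : Matrix m m ℝ) (i j k : m) :
    (edgeRay G i j ᵥ* G) k = G i k + G i j * G j k := by
  rw [edgeRay, Matrix.add_vecMul]
  simp [Matrix.single_vecMul]

theorem edgeRay_sum (G : Matrix m m ℝ) (i j : m) : ∑ k, edgeRay G i j k = 1 + G i j := by
  simp [edgeRay, Finset.sum_add_distrib]

theorem edgeRay_apply_of_ne (G : Matrix m m ℝ) {i j k : m} (hi : k ≠ i) (hj : k ≠ j) :
    edgeRay G i j k = 0 := by
  simp [edgeRay, hi, hj]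

namespace IsReciprocal

variable {G : Matrix m m ℝ}

theorem edgeRay_pos (hG : IsReciprocal G) {i j k : m} (hij : i ≠ j) (hk : k = i ∨ k = j) :
    0 < edgeRay G i j k := by
  rcases hk with rfl | rfl
  · simp [edgeRay, hij]
  · simpa [edgeRay, hij.symm] using hG.pos i k hij

theorem edgeRay_nonneg (hG : IsReciprocal G) {i j : m} (hij : i ≠ j) (k : m) :
    0 ≤ edgeRay G i j k := by
  by_cases hk : k = i ∨ k = j
  · exact (hG.edgeRay_pos hij hk).le
  · push Not at hk
    exact (edgeRay_apply_of_ne G hk.1 hk.2).ge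

theorem edgeRay_eq_zero_iff (hG : IsReciprocal G) {i j : m} (hij : i ≠ j) (k : m) :
    edgeRay G i j k = 0 ↔ k ≠ i ∧ k ≠ j := by
  refine ⟨fun h => ?_, fun h => edgeRay_apply_of_ne G h.1 h.2⟩
  by_contra hk
  exact (hG.edgeRay_pos hij (by tauto)).ne' h

/-- The value is `G i k + G i j * G j k`. For `k = i` it is `-1 + 1` by reciprocity, for `k = j` it
is `G i j - G i j`, and otherwise both summands are positive. -/
theorem edgeRay_vecMul_eq_zero_iff (hG : IsReciprocal G) {i j : m} (hij : i ≠ j) (k : m) :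
    (edgeRay G i j ᵥ* G) k = 0 ↔ k = i ∨ k = j := by
  rw [edgeRay_vecMul]
  constructor
  · intro h
    by_contra! hk
    have h1 := hG.pos i k hk.1.symm
    have h2 := mul_pos (hG.pos i j hij) (hG.pos j k hk.2.symm)
    linarith
  · rintro (rfl | rfl)
    · rw [hG.diag, hG.recip _ _ hij]
      norm_num
    · rw [hG.diag]
      ring

theorem edgeRay_vecMul_nonneg (hG : IsReciprocal G) {i j : m} (hij : i ≠ j) (k : m) :
    0 ≤ (edgeRay G i j ᵥ* G) k := by
  by_cases hk : k = i ∨ k = j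
  · exact ((hG.edgeRay_vecMul_eq_zero_iff hij k).2 hk).ge
  · push Not at hk
    rw [edgeRay_vecMul]
    have h1 := hG.pos i k hk.1.symm
    have h2 := mul_pos (hG.pos i j hij) (hG.pos j k hk.2.symm)
    linarith

theorem edgeRay_mem_gCone (hG : IsReciprocal G) {i j : m} (hij : i ≠ j) :
    edgeRay G i j ∈ gCone G :=
  ⟨hG.edgeRay_nonneg hij, hG.edgeRay_vecMul_nonneg hij⟩

/-- On the hyperplane given by the column `i`, every point is the linear combination of the rays
through `i` with its own coordinates as coefficients. -/
theorem eq_sum_of_vecMul_eq_zero (hG : IsReciprocal G) {x : m → ℝ} {i : m}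
    (hx : (x ᵥ* G) i = 0) : x = ∑ k ∈ Finset.univ.erase i, x k • edgeRay G k i := by
  have hxi : x i = ∑ k ∈ Finset.univ.erase i, x k * G k i := by
    rw [Matrix.vecMul, dotProduct, ← Finset.add_sum_erase _ _ (Finset.mem_univ i), hG.diag] at hx
    linarith
  ext j
  rw [Finset.sum_apply]
  by_cases hj : j = i
  · subst hj
    rw [hxi]
    refine Finset.sum_congr rfl fun k hk => ?_
    have hkj : j ≠ k := (Finset.ne_of_mem_erase hk).symm
    simp [edgeRay, hkj]
  · rw [Finset.sum_eq_single_of_mem j (by simp [hj])]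
    · simp [edgeRay, hj]
    · intro k _ hk
      rw [Pi.smul_apply, edgeRay_apply_of_ne G hk.symm hj, smul_zero]

/-- If `x i` were the only positive coordinate, column `i` would take the value `-x i < 0`. -/
theorem exists_ne_of_vecMul_nonneg (hG : IsReciprocal G) {x : m → ℝ} (hx : ∀ i, 0 ≤ x i) {i : m}
    (hxi : 0 < x i) (hi : 0 ≤ (x ᵥ* G) i) : ∃ j, i ≠ j ∧ 0 < x j := by
  by_contra! hcon
  rw [Matrix.vecMul, dotProduct, ← Finset.add_sum_erase _ _ (Finset.mem_univ i), hG.diag,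
    Finset.sum_eq_zero fun j hj => ?_] at hi
  · linarith
  · rw [le_antisymm (hcon j (Finset.ne_of_mem_erase hj).symm) (hx j), zero_mul]

/-- Induction on the size of the support. A point on a column hyperplane is a nonnegative
combination of rays by `eq_sum_of_vecMul_eq_zero`. From any other nonzero point, a multiple of a ray
supported on two positive coordinates is subtracted until an inequality becomes tight: either a
coordinate is lost or a column hyperplane is reached. -/
theorem gCone_subset (hG : IsReciprocal G) (K : PointedCone ℝ (m → ℝ))
    (hK : ∀ i j, i ≠ j → edgeRay G i j ∈ K) : gCone G ⊆ K := by
  have hsmul : ∀ (c : ℝ), 0 ≤ c → ∀ y ∈ K, c • y ∈ K := fun c hc y hy =>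
    K.smul_mem hc hy
  have htight : ∀ x : m → ℝ, (∀ i, 0 ≤ x i) → ∀ i, (x ᵥ* G) i = 0 → x ∈ K := by
    intro x hx i hi
    rw [hG.eq_sum_of_vecMul_eq_zero hi]
    exact K.sum_mem fun k hk => hsmul _ (hx k) _ (hK k i (Finset.ne_of_mem_erase hk))
  have key : ∀ (N : ℕ) (x : m → ℝ), x ∈ gCone G →
      (Finset.univ.filter fun i => x i ≠ 0).card = N → x ∈ K := by
    intro N
    induction N using Nat.strong_induction_on with
    | _ N ih =>
      rintro x hx rfl
      by_cases hx0 : x = 0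
      · exact hx0 ▸ K.zero_mem
      by_cases ht : ∃ i, (x ᵥ* G) i = 0
      · obtain ⟨i, hi⟩ := ht
        exact htight x hx.1 i hi
      push Not at ht
      obtain ⟨i, hi⟩ := Function.ne_iff.1 hx0
      have hxi : 0 < x i := lt_of_le_of_ne (hx.1 i) (Ne.symm hi)
      obtain ⟨j, hij, hxj⟩ := hG.exists_ne_of_vecMul_nonneg hx.1 hxi (hx.2 i)
      obtain ⟨t, ht0, htn, k, hk, hkt⟩ := exists_first_zero (Sum.elim x (x ᵥ* G))
        (Sum.elim (edgeRay G i j) (edgeRay G i j ᵥ* G))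
        (by rintro (k | k); exacts [hx.1 k, hx.2 k])
        ⟨Sum.inl i, hG.edgeRay_pos hij (Or.inl rfl)⟩
      have hmul : ∀ l, ((x - t • edgeRay G i j) ᵥ* G) l =
          (x ᵥ* G) l - t * (edgeRay G i j ᵥ* G) l := by
        intro l
        rw [Matrix.sub_vecMul, Matrix.smul_vecMul]
        rfl
      have hy : x - t • edgeRay G i j ∈ gCone G :=
        ⟨fun l => htn (Sum.inl l), fun l => by rw [hmul]; exact htn (Sum.inr l)⟩
      have hyK : x - t • edgeRay G i j ∈ K := by
        rcases k with k | k
        · refine ih _ (Finset.card_lt_card ?_) _ hy rfl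
          rw [Finset.ssubset_iff_of_subset]
          · refine ⟨k, ?_, by simpa using hkt⟩
            by_cases hki : k = i ∨ k = j
            · rcases hki with rfl | rfl
              exacts [by simpa using hxi.ne', by simpa using hxj.ne']
            · push Not at hki
              exact absurd (edgeRay_apply_of_ne G hki.1 hki.2) hk.ne'
          · intro l hl
            rw [Finset.mem_filter] at hl ⊢
            refine ⟨hl.1, fun h0 => hl.2 ?_⟩
            have hli : l ≠ i := by rintro rfl; exact hxi.ne' h0
            have hlj : l ≠ j := by rintro rfl; exact hxj.ne' h0
            simp [h0, edgeRay_apply_of_ne G hli hlj]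
        · exact htight _ hy.1 k ((hmul k).trans hkt)
      rw [← sub_add_cancel x (t • edgeRay G i j)]
      exact K.add_mem hyK (hsmul t ht0 _ (hK i j hij))
  exact fun x hx => key _ x hx rfl

end IsReciprocal

/-- The multiple of `e_i + G_ij e_j` with coordinate sum `c`. -/
noncomputable def edgeVertex (G : Matrix m m ℝ) (c : ℝ) (p : {p : m × m // p.1 ≠ p.2}) : m → ℝ :=
  (c / (1 + G p.1.1 p.1.2)) • edgeRay G p.1.1 p.1.2

namespace IsReciprocal

variable {G : Matrix m m ℝ} {c : ℝ}

theorem one_add_pos (hG : IsReciprocal G) (p : {p : m × m // p.1 ≠ p.2}) :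
    0 < 1 + G p.1.1 p.1.2 :=
  add_pos one_pos (hG.pos _ _ p.2)

theorem edgeVertex_sum (hG : IsReciprocal G) (c : ℝ) (p : {p : m × m // p.1 ≠ p.2}) :
    ∑ k, edgeVertex G c p k = c := by
  have : ∑ k, edgeVertex G c p k = c / (1 + G p.1.1 p.1.2) * ∑ k, edgeRay G p.1.1 p.1.2 k := by
    rw [Finset.mul_sum]
    rfl
  rw [this, edgeRay_sum, div_mul_cancel₀ _ (hG.one_add_pos p).ne']

theorem edgeVertex_mem (hG : IsReciprocal G) (hc : 0 ≤ c) (p : {p : m × m // p.1 ≠ p.2}) :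
    edgeVertex G c p ∈ gCone G :=
  smul_mem_gCone (hG.edgeRay_mem_gCone p.2) (div_nonneg hc (hG.one_add_pos p).le)

theorem edgeVertex_eq_zero_iff (hG : IsReciprocal G) (hc : 0 < c) (p : {p : m × m // p.1 ≠ p.2})
    (k : m) : edgeVertex G c p k = 0 ↔ k ≠ p.1.1 ∧ k ≠ p.1.2 := by
  rw [edgeVertex, Pi.smul_apply, smul_eq_zero_iff_right (div_pos hc (hG.one_add_pos p)).ne',
    hG.edgeRay_eq_zero_iff p.2]

theorem edgeVertex_vecMul_eq_zero_iff (hG : IsReciprocal G) (hc : 0 < c)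
    (p : {p : m × m // p.1 ≠ p.2}) (k : m) :
    (edgeVertex G c p ᵥ* G) k = 0 ↔ k = p.1.1 ∨ k = p.1.2 := by
  rw [edgeVertex, Matrix.smul_vecMul, Pi.smul_apply,
    smul_eq_zero_iff_right (div_pos hc (hG.one_add_pos p)).ne', hG.edgeRay_vecMul_eq_zero_iff p.2]

/-- The slice of `gCone G` at coordinate sum `c` is the convex hull of the points
`edgeVertex G c p`. -/
theorem slice_eq_convexHull (hG : IsReciprocal G) (hc : 0 < c) :
    {x | x ∈ gCone G ∧ ∑ i, x i = c} = convexHull ℝ (Set.range (edgeVertex G c)) := by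
  refine Set.Subset.antisymm ?_ (convexHull_min ?_ ?_)
  · rintro x ⟨hx, hxc⟩
    have hmem : x ∈ PointedCone.hull ℝ (Set.range (edgeVertex G c)) := by
      refine hG.gCone_subset _ (fun i j hij => ?_) hx
      have hp := hG.one_add_pos ⟨(i, j), hij⟩
      have : edgeRay G i j = ((1 + G i j) / c) • edgeVertex G c ⟨(i, j), hij⟩ := by
        rw [edgeVertex, smul_smul, div_mul_div_cancel₀ hc.ne', div_self hp.ne', one_smul]
      rw [this]
      exact Submodule.smul_mem _ (⟨(1 + G i j) / c, (div_pos hp hc).le⟩ : {c : ℝ // 0 ≤ c})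
        (PointedCone.subset_hull ⟨_, rfl⟩)
    obtain ⟨w, rfl⟩ := (Submodule.mem_span_range_iff_exists_fun _).1 hmem
    refine (convex_convexHull ℝ _).sum_mem (w := fun p => (w p : ℝ)) (fun p _ => (w p).2) ?_
      fun p _ => subset_convexHull ℝ _ ⟨p, rfl⟩
    -- All generators have coordinate sum `c`, so comparing coordinate sums forces the conic weights
    -- to add up to `1`.
    have hsum : ∑ i, (∑ p, w p • edgeVertex G c p) i = (∑ p, (w p : ℝ)) * c := by
      simp only [Finset.sum_apply]
      rw [Finset.sum_comm, Finset.sum_mul]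
      refine Finset.sum_congr rfl fun p _ => ?_
      calc ∑ i, (w p • edgeVertex G c p) i = (w p : ℝ) * ∑ i, edgeVertex G c p i := by
            rw [Finset.mul_sum]; rfl
        _ = _ := by rw [hG.edgeVertex_sum]
    exact mul_right_cancel₀ hc.ne' ((hsum.symm.trans hxc).trans (one_mul c).symm)
  · rintro _ ⟨p, rfl⟩
    exact ⟨hG.edgeVertex_mem hc.le p, hG.edgeVertex_sum c p⟩
  · rintro x ⟨hx, hxc⟩ y ⟨hy, hyc⟩ a b ha hb hab
    refine ⟨add_mem_gCone (smul_mem_gCone hx ha) (smul_mem_gCone hy hb), ?_⟩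
    simp only [Pi.add_apply, Pi.smul_apply, smul_eq_mul, Finset.sum_add_distrib, ← Finset.mul_sum,
      hxc, hyc]
    rw [← add_mul, hab, one_mul]

end IsReciprocal

end ReciprocalMatrices

/-! ### The hypersimplex as a slice of a reciprocal cone. -/

section Hypersimplices

/-- The affine maps `x ↦ x_i` and `x ↦ ⟨g_i, x⟩`, where `g_i` is the `i`-th column of `G`. -/
def gForms {m : Type*} [Fintype m] (G : Matrix m m ℝ) : m ⊕ m → (m → ℝ) →ᵃ[ℝ] ℝ :=
  Sum.elim (fun i => (LinearMap.proj i : (m → ℝ) →ₗ[ℝ] ℝ).toAffineMap)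
    fun i => ((LinearMap.proj i : (m → ℝ) →ₗ[ℝ] ℝ) ∘ₗ G.vecMulLinear).toAffineMap

/-- The embedding `A` and the level `c` let one statement serve both the hypersimplex (identity, `c
= 2`) and the polytope in a chart (`c = 1`). -/
theorem IsReciprocal.isDoubleDescription {m E : Type*} [Fintype m] [DecidableEq m]
    [NormedAddCommGroup E] [NormedSpace ℝ E] {G : Matrix m m ℝ} (hG : IsReciprocal G) {c : ℝ}
    (hc : 0 < c) {A : E →ᵃ[ℝ] (m → ℝ)} (hA : Function.Injective A)
    {v : {p : m × m // p.1 ≠ p.2} → E} (hv : ∀ p, A (v p) = edgeVertex G c p) {P : Set E}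
    (hP : ∀ x, x ∈ P ↔ A x ∈ gCone G ∧ ∑ i, A x i = c) :
    IsDoubleDescription P v fun k => (gForms G k).comp A where
  eq_hull := by
    apply hA.image_injective
    rw [AffineMap.image_convexHull, ← Set.range_comp, show A ∘ v = edgeVertex G c from funext hv,
      ← hG.slice_eq_convexHull hc]
    ext y
    refine ⟨?_, fun hy => ?_⟩
    · rintro ⟨x, hx, rfl⟩
      exact (hP x).1 hx
    · have hrange : convexHull ℝ (Set.range (edgeVertex G c)) ⊆ Set.range A := by
        rw [← show A ∘ v = edgeVertex G c from funext hv, Set.range_comp,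
          ← AffineMap.image_convexHull]
        exact Set.image_subset_range _ _
      obtain ⟨x, rfl⟩ := hrange ((hG.slice_eq_convexHull hc).le hy)
      exact ⟨x, (hP x).2 hy, rfl⟩
  nonneg := by
    rintro (k | k) x hx
    exacts [((hP x).1 hx).1.1 k, ((hP x).1 hx).1.2 k]
  lineMap_mem := by
    intro x hx y hy t ht
    refine (hP _).2 ⟨⟨fun k => ht (Sum.inl k), fun k => ht (Sum.inr k)⟩, ?_⟩
    rw [AffineMap.apply_lineMap, AffineMap.lineMap_apply_module]
    simp only [Pi.add_apply, Pi.smul_apply, smul_eq_mul, Finset.sum_add_distrib, ← Finset.mul_sum,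
      ((hP x).1 hx).2, ((hP y).1 hy).2]
    ring
  exists_ne := by
    intro p
    refine ⟨Sum.inl p.1.1, fun h0 => ?_⟩
    change A (v p) p.1.1 = 0 at h0
    rw [hv, hG.edgeVertex_eq_zero_iff hc] at h0
    exact h0.1 rfl

/-- The `G`-matrix of the hypersimplex `Δ_{n,2}`. -/
def hypersimplexGMatrix (n : ℕ) : Matrix (Fin n) (Fin n) ℝ :=
  Matrix.of fun i j => if i = j then -1 else 1

theorem isReciprocal_hypersimplexGMatrix (n : ℕ) : IsReciprocal (hypersimplexGMatrix n) where
  diag i := by simp [hypersimplexGMatrix]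
  pos i j h := by simp [hypersimplexGMatrix, h]
  recip i j h := by simp [hypersimplexGMatrix, h, h.symm]

theorem vecMul_hypersimplexGMatrix {n : ℕ} (x : Fin n → ℝ) (i : Fin n) :
    (x ᵥ* hypersimplexGMatrix n) i = ∑ j, x j - 2 * x i := by
  have h : ∀ j, x j * hypersimplexGMatrix n j i = x j - if j = i then 2 * x i else 0 := by
    intro j
    by_cases hj : j = i
    · subst hj
      simp [hypersimplexGMatrix]
      ring
    · simp [hypersimplexGMatrix, hj]
  rw [Matrix.vecMul, dotProduct, Finset.sum_congr rfl fun j _ => h j, Finset.sum_sub_distrib]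
  simp

/-- At coordinate sum `2` the column inequality reads `2 - 2 * x i ≥ 0`, that is `x i ≤ 1`, and the
normalized rays are the vectors `e_i + e_j`. -/
theorem hypersimplex_two_eq (n : ℕ) :
    hypersimplex n 2 = {x | x ∈ gCone (hypersimplexGMatrix n) ∧ ∑ i, x i = 2} := by
  have hG := isReciprocal_hypersimplexGMatrix n
  rw [hG.slice_eq_convexHull two_pos, hypersimplex]
  refine Set.Subset.antisymm (convexHull_min ?_ (convex_convexHull ℝ _)) (convexHull_mono ?_)
  · rintro x ⟨hx, hsum⟩
    push_cast at hsum
    rw [← hG.slice_eq_convexHull two_pos]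
    have h01 : ∀ i, 0 ≤ x i ∧ x i ≤ 1 := fun i => by rcases hx i with h | h <;> simp [h]
    refine ⟨⟨fun i => (h01 i).1, fun i => ?_⟩, hsum⟩
    rw [vecMul_hypersimplexGMatrix, hsum]
    linarith [(h01 i).2]
  · rintro _ ⟨⟨⟨i, j⟩, hij⟩, rfl⟩
    refine ⟨fun k => ?_, by rw [hG.edgeVertex_sum]; norm_num⟩
    have hij' : i ≠ j := hij
    have h2 : (2 : ℝ) / (1 + 1) = 1 := by norm_num
    simp only [edgeVertex, edgeRay, hypersimplexGMatrix, Matrix.of_apply, hij', if_false, h2,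
      one_smul, Pi.add_apply, Pi.single_apply]
    by_cases hi : k = i
    · subst hi
      simp [hij']
    · by_cases hj : k = j
      · subst hj
        simp [hij'.symm]
      · simp [hi, hj]

theorem isDoubleDescription_hypersimplex (n : ℕ) :
    IsDoubleDescription (hypersimplex n 2) (edgeVertex (hypersimplexGMatrix n) 2)
      (gForms (hypersimplexGMatrix n)) :=
  (isReciprocal_hypersimplexGMatrix n).isDoubleDescription two_pos
    (A := AffineMap.id ℝ (Fin n → ℝ)) Function.injective_id (fun _ => rfl)
    fun x => by rw [hypersimplex_two_eq]; rfl

theorem hypersimplexG_two_eq (n : ℕ) (i : Fin n) :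
    (hypersimplexG n 2 i).1 =
      {x ∈ hypersimplex n 2 | gForms (hypersimplexGMatrix n) (Sum.inr i) x = 0} := by
  ext x
  refine and_congr_right fun hx => ?_
  rw [hypersimplex_two_eq] at hx
  change x i = 1 ↔ (x ᵥ* hypersimplexGMatrix n) i = 0
  rw [vecMul_hypersimplexGMatrix, hx.2]
  constructor <;> intro h <;> linarith

theorem hypersimplex_one_eq (n : ℕ) :
    hypersimplex n 1 = convexHull ℝ (Set.range fun i : Fin n => (Pi.single i 1 : Fin n → ℝ)) := by
  rw [hypersimplex]
  congr 1
  ext x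
  refine ⟨?_, ?_⟩
  · rintro ⟨hx, hsum⟩
    have hnn : ∀ i, 0 ≤ x i := fun i => by rcases hx i with h | h <;> simp [h]
    obtain ⟨i, -, hi⟩ : ∃ i ∈ Finset.univ, x i ≠ 0 :=
      Finset.exists_ne_zero_of_sum_ne_zero (by rw [hsum]; norm_num)
    have hi1 : x i = 1 := (hx i).resolve_left hi
    rw [← Finset.add_sum_erase _ _ (Finset.mem_univ i), hi1, Nat.cast_one, add_eq_left,
      Finset.sum_eq_zero_iff_of_nonneg fun j _ => hnn j] at hsum
    refine ⟨i, funext fun j => ?_⟩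
    by_cases hj : j = i
    · subst hj
      simp [hi1]
    · simp [hj, hsum j (by simp [hj])]
  · rintro ⟨i, rfl⟩
    refine ⟨fun j => ?_, by simp⟩
    by_cases hj : j = i
    · subst hj
      simp
    · simp [hj]

/-! ### Polytopes in affine charts, their `G`-matrices and facets. -/

section Chart

variable {n : ℕ} {E : Type*} [NormedAddCommGroup E] [NormedSpace ℝ E]
  {L : (Fin n → ℝ) ≃ₗ[ℝ] ℝ × E} {G : Matrix (Fin n) (Fin n) ℝ}

/-- The affine embedding `p ↦ L⁻¹ (1, p)`. -/
def chart (L : (Fin n → ℝ) ≃ₗ[ℝ] ℝ × E) : E →ᵃ[ℝ] (Fin n → ℝ) where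
  toFun p := L.symm (1, p)
  linear := L.symm.toLinearMap ∘ₗ LinearMap.inr ℝ ℝ E
  map_vadd' p q := by
    simp [← map_add]

theorem chart_injective (L : (Fin n → ℝ) ≃ₗ[ℝ] ℝ × E) : Function.Injective (chart L) :=
  fun _ _ h => congrArg Prod.snd (L.symm.injective h)

theorem chart_snd (hL : ∀ x, (L x).1 = ∑ i, x i) {x : Fin n → ℝ} (hx : ∑ i, x i = 1) :
    chart L (L x).2 = x := by
  change L.symm (1, (L x).2) = x
  rw [← hx, ← hL, Prod.mk.eta, L.symm_apply_apply]

theorem sum_chart (hL : ∀ x, (L x).1 = ∑ i, x i) (p : E) : ∑ i, chart L p i = 1 := by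
  rw [← hL]
  exact congrArg Prod.fst (L.apply_symm_apply (1, p))

/-- The polytope in the chart given by `L` whose homogenization is `gCone G`. -/
def gPolytope (L : (Fin n → ℝ) ≃ₗ[ℝ] ℝ × E) (G : Matrix (Fin n) (Fin n) ℝ) : Set E :=
  {p | chart L p ∈ gCone G}

theorem isDoubleDescription_gPolytope (hL : ∀ x, (L x).1 = ∑ i, x i) (hG : IsReciprocal G) :
    IsDoubleDescription (gPolytope L G) (fun p => (L (edgeVertex G 1 p)).2)
      fun k => (gForms G k).comp (chart L) :=
  hG.isDoubleDescription one_pos (chart_injective L)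
    (fun p => chart_snd hL (hG.edgeVertex_sum 1 p))
    fun p => (and_iff_left (sum_chart hL p)).symm

/-- A point of `gCone G` with coordinate sum `0` is `0`; any other rescales to coordinate sum `1`,
which is height `1` under `L`. -/
theorem homogenization_gPolytope (hL : ∀ x, (L x).1 = ∑ i, x i) :
    homogenization (gPolytope L G) = L '' gCone G := by
  refine Set.Subset.antisymm ?_ ?_
  · intro y hy
    let K : PointedCone ℝ (ℝ × E) :=
      { carrier := L '' gCone G
        add_mem' := by
          rintro _ _ ⟨x, hx, rfl⟩ ⟨y, hy, rfl⟩
          exact ⟨x + y, add_mem_gCone hx hy, map_add L x y⟩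
        zero_mem' := ⟨0, ⟨fun _ => le_rfl, fun i => by simp⟩, map_zero L⟩
        smul_mem' := by
          rintro c _ ⟨x, hx, rfl⟩
          exact ⟨(c : ℝ) • x, smul_mem_gCone hx c.2, map_smul L (c : ℝ) x⟩ }
    have hle : PointedCone.hull ℝ (({1} : Set ℝ) ×ˢ gPolytope L G) ≤ K := by
      refine Submodule.span_le.2 ?_
      rintro ⟨t, p⟩ ⟨ht, hp⟩
      obtain rfl : t = 1 := ht
      exact ⟨_, hp, L.apply_symm_apply _⟩
    exact hle hy
  · rintro _ ⟨x, hx, rfl⟩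
    have hs : 0 ≤ ∑ i, x i := Finset.sum_nonneg fun i _ => hx.1 i
    rcases hs.eq_or_lt with hs0 | hspos
    · have hx0 : x = 0 := funext fun i =>
        (Finset.sum_eq_zero_iff_of_nonneg fun j _ => hx.1 j).1 hs0.symm i (Finset.mem_univ i)
      rw [hx0, map_zero]
      exact Submodule.zero_mem _
    · set s := ∑ i, x i with hsdef
      have hsum : ∑ i, (s⁻¹ • x) i = 1 := by
        simp only [Pi.smul_apply, smul_eq_mul, ← Finset.mul_sum, ← hsdef]
        exact inv_mul_cancel₀ hspos.ne'
      have hmem : L (s⁻¹ • x) ∈ PointedCone.hull ℝ (({1} : Set ℝ) ×ˢ gPolytope L G) := by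
        refine PointedCone.subset_hull ⟨(hL _).trans hsum, ?_⟩
        change chart L _ ∈ gCone G
        rw [chart_snd hL hsum]
        exact smul_mem_gCone hx (inv_nonneg.2 hs)
      have : L x = s • L (s⁻¹ • x) := by
        rw [← map_smul, smul_smul, mul_inv_cancel₀ hspos.ne', one_smul]
      rw [this]
      exact PointedCone.smul_mem _ hs hmem

/-- The right-hand side involves neither `G` nor `c`, which is why all these polytopes share one
face lattice. -/
theorem gForms_edgeVertex_eq_zero_iff (hG : IsReciprocal G) {c : ℝ} (hc : 0 < c)
    (k : Fin n ⊕ Fin n) (p : {p : Fin n × Fin n // p.1 ≠ p.2}) :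
    gForms G k (edgeVertex G c p) = 0 ↔
      Sum.elim (fun i => i ≠ p.1.1 ∧ i ≠ p.1.2) (fun i => i = p.1.1 ∨ i = p.1.2) k := by
  rcases k with k | k
  exacts [hG.edgeVertex_eq_zero_iff hc p k, hG.edgeVertex_vecMul_eq_zero_iff hc p k]

theorem isGMatrix_and_isCombHypersimplex [FiniteDimensional ℝ E]
    (hL : ∀ x, (L x).1 = ∑ i, x i) (hG : IsReciprocal G) :
    IsGMatrix n 2 (gPolytope L G) G ∧ IsCombHypersimplex n 2 (gPolytope L G) := by
  have H := isDoubleDescription_gPolytope hL hG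
  obtain ⟨Φ, hΦ⟩ := (isDoubleDescription_hypersimplex n).exists_orderIso H fun k p => by
    rw [gForms_edgeVertex_eq_zero_iff (isReciprocal_hypersimplexGMatrix n) two_pos,
      AffineMap.comp_apply, chart_snd hL (hG.edgeVertex_sum 1 p),
      gForms_edgeVertex_eq_zero_iff hG one_pos]
  exact ⟨⟨L, homogenization_gPolytope hL, Φ, fun i => hΦ (Sum.inl i) _ rfl,
    fun i => hΦ (Sum.inr i) _ (hypersimplexG_two_eq n i)⟩, H.isPolytope, ⟨Φ⟩⟩

/-- A left null vector of `G` gives a common point of the affine hulls of the `G`-facets. -/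
theorem mem_affineSpan_of_vecMul_eq_zero (hL : ∀ x, (L x).1 = ∑ i, x i) (hG : IsReciprocal G)
    {y : Fin n → ℝ} (hy : y ᵥ* G = 0) (hy1 : ∑ i, y i = 1) (i : Fin n) :
    (L y).2 ∈ affineSpan ℝ {p ∈ gPolytope L G | gForms G (Sum.inr i) (chart L p) = 0} := by
  have hyi := hG.eq_sum_of_vecMul_eq_zero (congrFun hy i)
  have hpos : ∀ k ∈ Finset.univ.erase i, 0 < 1 + G k i := fun k hk =>
    hG.one_add_pos ⟨(k, i), Finset.ne_of_mem_erase hk⟩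
  -- Rescaling the rays to coordinate sum `1` turns the coefficients `y k` into `y k * (1 + G k i)`.
  -- They may be negative, so only the affine hull is reached.
  have hw : ∑ k ∈ Finset.univ.erase i, y k * (1 + G k i) = 1 := by
    refine Eq.trans ?_ hy1
    conv_rhs => rw [hyi]
    simp only [Finset.sum_apply]
    rw [Finset.sum_comm]
    refine Finset.sum_congr rfl fun k _ => ?_
    rw [← edgeRay_sum, Finset.mul_sum]
    rfl
  set q : Fin n → E := fun k => (L ((1 / (1 + G k i)) • edgeRay G k i)).2 with hq
  have hyq : (L y).2 = ∑ k ∈ Finset.univ.erase i, (y k * (1 + G k i)) • q k := by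
    conv_lhs => rw [hyi]
    rw [map_sum, Prod.snd_sum]
    refine Finset.sum_congr rfl fun k hk => ?_
    rw [hq, ← Prod.smul_snd, ← map_smul, smul_smul, mul_assoc,
      mul_one_div_cancel (hpos k hk).ne', mul_one]
  rw [hyq, ← Finset.affineCombination_eq_linear_combination _ _ _ hw]
  refine affineSpan_mono ℝ ?_ (affineCombination_mem_affineSpan_image hw
    (s' := ↑(Finset.univ.erase i)) (fun k hk hk' => absurd hk hk') q)
  rintro _ ⟨k, hk, rfl⟩
  have hki : k ≠ i := Finset.ne_of_mem_erase hk
  refine ⟨(isDoubleDescription_gPolytope hL hG).vertex_mem ⟨(k, i), hki⟩, ?_⟩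
  have := chart_snd hL (hG.edgeVertex_sum 1 ⟨(k, i), hki⟩)
  rw [show q k = (L (edgeVertex G 1 ⟨(k, i), hki⟩)).2 from rfl, this,
    gForms_edgeVertex_eq_zero_iff hG one_pos]
  exact Or.inr rfl

/-- The facet `x_k = 0` has at least as many vertices as there are pairs of indices other than `k`. -/
theorem card_le_of_combIso_facet [FiniteDimensional ℝ E] {ι E' : Type*} [Fintype ι]
    [NormedAddCommGroup E'] [NormedSpace ℝ E'] (hL : ∀ x, (L x).1 = ∑ i, x i)
    (hG : IsReciprocal G) {v : ι → E'} {k : Fin n}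
    (hQ : CombIso (convexHull ℝ (Set.range v))
      {p ∈ gPolytope L G | gForms G (Sum.inl k) (chart L p) = 0}) :
    Fintype.card {s : Finset (Fin n) // s.card = 2 ∧ k ∉ s} ≤ Fintype.card ι := by
  have H := isDoubleDescription_gPolytope hL hG
  -- The face of `s` is cut out by the vanishing of all coordinates outside `s`. Unordered pairs are
  -- used because both orders give the same vertex.
  refine card_le_of_combIso hQ
    (f := fun s : {s : Finset (Fin n) // s.card = 2 ∧ k ∉ s} =>
      {p ∈ gPolytope L G | ∀ j, (∃ l ∉ s.1, j = Sum.inl l) → gForms G j (chart L p) = 0}) ?_ ?_ ?_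
  · rintro ⟨s, hs, hk⟩
    exact (H.isExposed_inter_facets _).mono (Set.sep_subset _ _)
      fun p hp => ⟨hp.1, hp.2 _ ⟨k, hk, rfl⟩⟩
  · rintro ⟨s, hs, hk⟩
    obtain ⟨i, j, hij, rfl⟩ := Finset.card_eq_two.1 hs
    refine ⟨_, H.vertex_mem ⟨(i, j), hij⟩, ?_⟩
    rintro _ ⟨l, hl, rfl⟩
    rw [chart_snd hL (hG.edgeVertex_sum 1 _), gForms_edgeVertex_eq_zero_iff hG one_pos]
    simpa using hl
  · rintro ⟨s, hs, hks⟩ ⟨t, ht, hkt⟩ hst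
    refine Set.disjoint_left.2 ?_
    rintro p ⟨hp, hps⟩ ⟨-, hpt⟩
    have hp' : chart L p ∈ gCone G := hp
    -- A common point has at least two positive coordinates, all lying in both `s` and `t`, so the
    -- two pairs coincide.
    have hmem : ∀ l, 0 < chart L p l → l ∈ s ∧ l ∈ t := by
      intro l hl
      by_contra hcon
      rw [not_and_or] at hcon
      rcases hcon with h | h
      exacts [hl.ne' (hps _ ⟨l, h, rfl⟩), hl.ne' (hpt _ ⟨l, h, rfl⟩)]
    obtain ⟨i, -, hi⟩ : ∃ i ∈ Finset.univ, chart L p i ≠ 0 :=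
      Finset.exists_ne_zero_of_sum_ne_zero (by rw [sum_chart hL]; exact one_ne_zero)
    have hi' : 0 < chart L p i := lt_of_le_of_ne (hp'.1 i) (Ne.symm hi)
    obtain ⟨j, hij, hj⟩ := hG.exists_ne_of_vecMul_nonneg hp'.1 hi' (hp'.2 i)
    have hpair : ∀ u : Finset (Fin n), u.card = 2 → i ∈ u → j ∈ u → {i, j} = u := by
      intro u hu hiu hju
      refine Finset.eq_of_subset_of_card_le ?_ ?_
      · intro l hl
        rcases Finset.mem_insert.1 hl with rfl | hl
        exacts [hiu, Finset.mem_singleton.1 hl ▸ hju]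
      · rw [hu, Finset.card_pair hij]
    exact hst (Subtype.ext ((hpair s hs (hmem i hi').1 (hmem j hj).1).symm.trans
      (hpair t ht (hmem i hi').2 (hmem j hj).2)))

end Chart

/-- The coordinate change `x ↦ (∑ x_i, (x_1, …, x_n))` on `ℝ^{n+1}`. -/
def sumTailEquiv (n : ℕ) : (Fin (n + 1) → ℝ) ≃ₗ[ℝ] ℝ × (Fin n → ℝ) where
  toFun x := (∑ i, x i, Fin.tail x)
  invFun y := Fin.cons (y.1 - ∑ i, y.2 i) y.2
  map_add' x y := by
    refine Prod.ext ?_ rfl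
    simp [Finset.sum_add_distrib]
  map_smul' c x := by
    refine Prod.ext ?_ rfl
    simp [Finset.mul_sum]
  left_inv x := by
    ext i
    refine Fin.cases ?_ (fun i => ?_) i
    · simp [Fin.sum_univ_succ, Fin.tail]
    · simp [Fin.tail]
  right_inv y := by
    refine Prod.ext ?_ rfl
    simp [Fin.sum_univ_succ]

/-! ### The explicit singular matrix. -/

theorem isReciprocal_singularGMatrix : IsReciprocal singularGMatrix := by
  have h6 : √6 * √6 = (6 : ℝ) := Real.mul_self_sqrt (by norm_num)
  have h0 : 0 ≤ √6 := Real.sqrt_nonneg 6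
  have hlt : 0 < 5 - 2 * √6 := by nlinarith
  have hlt' : 0 < 5 + 2 * √6 := by positivity
  have h1 : (5 + 2 * √6) * (5 - 2 * √6) = 1 := by linear_combination -4 * h6
  have h1' : (5 - 2 * √6) * (5 + 2 * √6) = 1 := by linear_combination -4 * h6
  refine ⟨fun i => ?_, fun i j hij => ?_, fun i j hij => ?_⟩
  · fin_cases i <;> rfl
  · fin_cases i <;> fin_cases j <;>
      first
      | exact absurd rfl hij
      | exact hlt
      | exact hlt'
      | exact one_pos
  · fin_cases i <;> fin_cases j <;>
      first
      | exact absurd rfl hij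
      | exact h1
      | exact h1'
      | exact one_mul 1

theorem exists_vecMul_singularGMatrix_eq_zero :
    ∃ y : Fin 6 → ℝ, y ᵥ* singularGMatrix = 0 ∧ ∑ i, y i = 1 := by
  -- For `(a, a, a, b, b, b)` the columns give `9a + 3b = 0` and `3a + b = 0`, because `-1 + (5 +
  -- 2√6) + (5 - 2√6) = 9`. These are proportional, and coordinate sum `1` fixes the scale.
  refine ⟨![-1/6, -1/6, -1/6, 1/2, 1/2, 1/2], ?_, ?_⟩
  · ext i
    fin_cases i <;> simp [singularGMatrix, Matrix.vecMul, dotProduct, Fin.sum_univ_succ] <;> ring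
  · simp [Fin.sum_univ_succ]
    norm_num

theorem not_isGGeneric_gPolytope :
    ¬ IsGGeneric 6 2 (gPolytope (sumTailEquiv 5) singularGMatrix) := by
  have hL : ∀ x, (sumTailEquiv 5 x).1 = ∑ i, x i := fun _ => rfl
  have hG := isReciprocal_singularGMatrix
  have H := isDoubleDescription_gPolytope hL hG
  obtain ⟨y, hy, hy1⟩ := exists_vecMul_singularGMatrix_eq_zero
  refine fun hgen => hgen.1 ⟨(sumTailEquiv 5 y).2, fun F hF => ?_⟩
  have hne : ∀ k, ∃ p : {p : Fin 6 × Fin 6 // p.1 ≠ p.2},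
      (gForms singularGMatrix k).comp (chart (sumTailEquiv 5))
        (sumTailEquiv 5 (edgeVertex singularGMatrix 1 p)).2 ≠ 0 := by
    simp only [AffineMap.comp_apply, chart_snd hL (hG.edgeVertex_sum 1 _), ne_eq,
      gForms_edgeVertex_eq_zero_iff hG one_pos]
    rintro (k | k)
    exacts [by revert k; simp only [Sum.elim_inl]; decide,
      by revert k; simp only [Sum.elim_inr]; decide]
  obtain ⟨k | k, rfl⟩ := H.eq_of_isFacet hne hF.1
  -- A facet `x_k = 0` would need ten disjoint nonempty faces in a polytope with five vertices.
  · have hcomb : CombIso (hypersimplex 5 1) _ := hF.2.2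
    rw [hypersimplex_one_eq] at hcomb
    have hcard := card_le_of_combIso_facet hL hG hcomb
    have h10 : ∀ k : Fin 6, Fintype.card {s : Finset (Fin 6) // s.card = 2 ∧ k ∉ s} = 10 := by
      decide
    rw [h10, Fintype.card_fin] at hcard
    omega
  · exact mem_affineSpan_of_vecMul_eq_zero hL hG hy hy1 k

end Hypersimplices

theorem mainTheorem11 :
    (∃ P : Set (Fin 5 → ℝ),
      IsCombHypersimplex 6 2 P ∧ ¬ IsGGeneric 6 2 P ∧ IsGMatrix 6 2 P singularGMatrix) ∧
    singularGMatrix.det = 0 := by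
  obtain ⟨y, hy, hy1⟩ := exists_vecMul_singularGMatrix_eq_zero
  obtain ⟨hmat, hcomb⟩ := isGMatrix_and_isCombHypersimplex (L := sumTailEquiv 5) (fun _ => rfl)
    isReciprocal_singularGMatrix
  refine ⟨⟨_, hcomb, not_isGGeneric_gPolytope, hmat⟩,
    Matrix.exists_vecMul_eq_zero_iff.1 ⟨y, ?_, hy⟩⟩
  rintro rfl
  simp at hy1
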